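/- Let $q\ge 4$ be a prime power and let $\mathcal C$ be a $[q^2+1,4,q^2-q]$ linear code over $\mathrm{GF}(q)$ (an ovoid code), that is, a $4$-dimensional subspace of $\mathrm{GF}(q)^{q^2+1}$ with minimum Hamming distance $q^2-q$. For a linear code $\mathcal D$ let $\mathcal D^\perp$ be its dual code for the standard dot product, and for a coordinate $t_1$ let $\mathcal D_{\{t_1\}}$ be the shortened code, obtained from the codewords of $\mathcal D$ that are $0$ at $t_1$ by deleting the coordinate $t_1$. Let $\mathcal P(\mathcal D)$ be the set of coordinate positions of $\mathcal D$, and let $\mathcal B_w(\mathcal D)$ be the multiset of the supports of all codewords of Hamming weight $w$ in $\mathcal D$, with every multiplicity divided by $q-1$. A pair $(\mathcal P,\mathcal B)$, where $\mathcal P$ is a set of $n$ points and $\mathcal B$ is a multiset of $k$-subsets (blocks) of $\mathcal P$, is a $t$-$(n,k,\lambda)$ design if every $t$-subset of $\mathcal P$ is contained in exactly $\lambda$ blocks, counted with multiplicity; it is simple if no block is repeated; its complement is obtained by replacing every block by its complement in $\mathcal P$. Then for every coordinate $t_1$ the following hold. 1. $(\mathcal P(\mathcal C_{\{t_1\}}),\mathcal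 B_{q^2-q}(\mathcal C_{\{t_1\}}))$ is a simple $2$-$(q^2,\,q^2-q,\,q^2-q-1)$ design. 2. $(\mathcal P((\mathcal C_{\{t_1\}})^\perp),\mathcal B_{3}((\mathcal C_{\{t_1\}})^\perp))$ is a simple $2$-$(q^2,3,\lambda)$ design for some positive integer $\lambda$. 3. $(\mathcal P(((\mathcal C^\perp)_{\{t_1\}})^\perp),\mathcal B_{q^2-q-1}(((\mathcal C^\perp)_{\{t_1\}})^\perp))$ is a simple $2$-$(q^2,\,q^2-q-1,\,(q-2)(q^2-q-1))$ design. The complement of this design is a $2$-$(q^2,q+1,q)$ design. 4. $(\mathcal P(((\mathcal C^\perp)_{\{t_1\}})^\perp),\mathcal B_{q^2-q}(((\mathcal C^\perp)_{\{t_1\}})^\perp))$ is a simple $2$-$(q^2,\,q^2-q,\,q^2-q-1)$ design. The complement of this design is a Steiner system $2$-$(q^2,q,1)$, and it is an affine plane: any two distinct points lie on exactly one block, through every point off a block there is exactly one block disjoint from it, every block has at least two points, and there are three points that do not lie on a common block. 5. $(\mathcal P((\mathcal C^\perp)_{\{t_1\}}),\mathcal B_{4}((\mathcal C^\perp)_{\{t_1\}}))$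 is a simple $2$-$(q^2,4,\lambda)$ design for some positive integer $\lambda$. -/

import Mathlib

namespace ShortenedCodes

section Codes

variable {K : Type*} [Field K] {ι : Type*}

/-- `C` is an `[n, k, d]` code: `n` coordinates, dimension `k`, and `d` is the least Hamming
distance between two distinct codewords. -/
def IsCode [DecidableEq K] [Fintype ι] (C : Submodule K (ι → K)) (n k d : ℕ) : Prop :=
  Fintype.card ι = n ∧ Module.finrank K C = k ∧
    IsLeast {e : ℕ | ∃ x ∈ C, ∃ y ∈ C, x ≠ y ∧ hammingDist x y = e} d

/-- The dual code: all vectors whose standard dot product with every codeword is zero. -/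
def dual [Fintype ι] (C : Submodule K (ι → K)) : Submodule K (ι → K) where
  carrier := {x | ∀ c ∈ C, c ⬝ᵥ x = 0}
  add_mem' := by
    intro a b ha hb c hc
    rw [dotProduct_add, ha c hc, hb c hc, add_zero]
  zero_mem' := by
    intro c _
    exact dotProduct_zero c
  smul_mem' := by
    intro r a ha c hc
    rw [dotProduct_smul, ha c hc, smul_zero]

/-- The subcode of all codewords that vanish on the set `T` of coordinates. -/
def zeroOn (C : Submodule K (ι → K)) (T : Finset ι) : Submodule K (ι → K) where
  carrier := {c | c ∈ C ∧ ∀ i ∈ T, c i = 0}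
  add_mem' := by
    intro a b ha hb
    refine ⟨C.add_mem ha.1 hb.1, fun i hi => ?_⟩
    rw [Pi.add_apply, ha.2 i hi, hb.2 i hi, add_zero]
  zero_mem' := ⟨C.zero_mem, fun _ _ => rfl⟩
  smul_mem' := by
    intro r a ha
    refine ⟨C.smul_mem r ha.1, fun i hi => ?_⟩
    rw [Pi.smul_apply, ha.2 i hi, smul_zero]

/-- The punctured code: delete the coordinates in `T` from every codeword. -/
def puncture (C : Submodule K (ι → K)) (T : Finset ι) : Submodule K ({i // i ∉ T} → K) :=
  C.map (LinearMap.funLeft K K (Subtype.val : {i // i ∉ T} → ι))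

/-- The shortened code: puncture on `T` the subcode of codewords that vanish on `T`. -/
def shorten (C : Submodule K (ι → K)) (T : Finset ι) : Submodule K ({i // i ∉ T} → K) :=
  puncture (zeroOn C T) T

/-- The support of a vector, as a set of coordinate positions. -/
def supp [DecidableEq K] [Fintype ι] (c : ι → K) : Finset ι :=
  Finset.univ.filter fun i => c i ≠ 0

end Codes

section Designs

variable {P : Type*} [DecidableEq P]

/-- The multiset `(1 / m) S`: every multiplicity of `S` is divided by `m`. -/
def divMultiplicities (S : Multiset (Finset P)) (m : ℕ) : Multiset (Finset P) :=
  ∑ s ∈ S.toFinset, Multiset.replicate (S.count s / m) s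

open Classical in
/-- The multiset `(1 / (q - 1)) {{ Supp c : c ∈ C, wt c = w }}`, where `q` is the size of the field.
For `w > 0` all the divisions are exact, since nonzero scalar multiples of a codeword
have the same support. -/
noncomputable def blocks {K : Type*} [Field K] [Fintype K] [DecidableEq K] [Fintype P]
    (C : Submodule K (P → K)) (w : ℕ) : Multiset (Finset P) :=
  divMultiplicities
    ((Finset.univ.filter fun c : P → K => c ∈ C ∧ hammingNorm c = w).val.map supp)
    (Fintype.card K - 1)

/-- The multiset `B` of blocks is a `t`-`(n, k, l)` design on the point set `P`: every block has
`k` points, and every set of `t` points lies in exactly `l` blocks, counted with multiplicity. -/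
structure IsDesign [Fintype P] (B : Multiset (Finset P)) (t n k l : ℕ) : Prop where
  card_points : Fintype.card P = n
  one_le_t : 1 ≤ t
  t_le : t ≤ n
  one_le_k : 1 ≤ k
  k_le : k ≤ n
  card_block : ∀ b ∈ B, b.card = k
  card_through : ∀ s : Finset P, s.card = t → (B.filter fun b => s ⊆ b).card = l

/-- A simple design is one without repeated blocks. -/
def IsSimpleDesign [Fintype P] (B : Multiset (Finset P)) (t n k l : ℕ) : Prop :=
  IsDesign B t n k l ∧ B.Nodup

/-- A Steiner system `S(t, k, n)` is a `t`-`(n, k, 1)` design with `t ≥ 2`. -/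
def IsSteinerSystem [Fintype P] (B : Multiset (Finset P)) (t k n : ℕ) : Prop :=
  2 ≤ t ∧ IsDesign B t n k 1

/-- The blocks of the complementary design: the complements of the blocks. -/
def complBlocks [Fintype P] (B : Multiset (Finset P)) : Multiset (Finset P) :=
  B.map fun b => bᶜ

/-- The blocks in `B` are the lines of an affine plane with point set `P`: two distinct points are
on exactly one line, through a point off a line there is exactly one line disjoint from it,
every line has at least two points, and there are three non-collinear points. -/
structure IsAffinePlane (B : Multiset (Finset P)) : Prop where
  nodup : B.Nodup
  two_le_card : ∀ l ∈ B, 2 ≤ l.card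
  join : ∀ x y : P, x ≠ y → ∃! l, l ∈ B ∧ x ∈ l ∧ y ∈ l
  parallel : ∀ l ∈ B, ∀ x : P, x ∉ l → ∃! m, m ∈ B ∧ x ∈ m ∧ Disjoint l m
  noncollinear : ∃ x y z : P, x ≠ y ∧ x ≠ z ∧ y ≠ z ∧ ∀ l ∈ B, ¬ (x ∈ l ∧ y ∈ l ∧ z ∈ l)

end Designs

end ShortenedCodes

/-! The coordinates of `C` behave like the points of an ovoid in PG(3,q), and this geometry is
recovered by counting zeros of words. A nonzero word has at most q+1 zeros. Double counting over
subcodes then shows that any three coordinates impose independent conditions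
(`IsOvoidCode.finrank_zeroOn_three`), so nonzero words of `dual C` have weight at least 4, and that
a nonzero word with two zeros has exactly q+1 (`IsOvoidCode.card_zeros_eq`). Hence the zero sets of
size q+1, the circles, form an inversive plane: three points lie on exactly one
(`IsOvoidCode.existsUnique_circle`). By the corank formula `finrank_zeroOn_add_card`, the supports
of weight 4 in `dual C` are the quadruples lying on a circle.

Now remove the point t₁. Circles through it become the lines of an affine plane of order q; the
others form a 2-(q²,q+1,q) design (`IsPointedPlane.isPairDesign_circles`). Duality exchanges
shortening and puncturing, so every code in the theorem is `C` or `dual C`, shortened or punctured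
at t₁, and its blocks are complements of lines, complements of circles, collinear triples, or
quadruples inside a line or a circle. Minimum weight words of `C` or `dual C` with the same support
are proportional, so dividing by q-1 leaves each block once. The parameters come from double
counting. -/

namespace ShortenedCodes

/-! ### Dual codes, shortening and puncturing -/

section Duality

variable {K : Type*} [Field K] {ι : Type*}

lemma mem_dual [Fintype ι] {C : Submodule K (ι → K)} {x : ι → K} :
    x ∈ dual C ↔ ∀ c ∈ C, c ⬝ᵥ x = 0 := Iff.rfl

lemma mem_zeroOn {C : Submodule K (ι → K)} {T : Finset ι} {x : ι → K} :
    x ∈ zeroOn C T ↔ x ∈ C ∧ ∀ i ∈ T, x i = 0 := Iff.rfl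

lemma mem_puncture {C : Submodule K (ι → K)} {T : Finset ι} {x : {i // i ∉ T} → K} :
    x ∈ puncture C T ↔ ∃ c ∈ C, (fun i : {i // i ∉ T} => c i) = x := Iff.rfl

lemma mem_shorten {C : Submodule K (ι → K)} {T : Finset ι} {x : {i // i ∉ T} → K} :
    x ∈ shorten C T ↔ ∃ c ∈ C, (∀ i ∈ T, c i = 0) ∧ (fun i : {i // i ∉ T} => c i) = x := by
  simp only [shorten, mem_puncture, mem_zeroOn, and_assoc]

lemma zeroOn_mono {C : Submodule K (ι → K)} {S T : Finset ι} (h : S ⊆ T) :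
    zeroOn C T ≤ zeroOn C S := fun _ hx => ⟨hx.1, fun i hi => hx.2 i (h hi)⟩

/-- The dot product identifies the dual code with the annihilator in the dual space, whose dimension
is known. -/
lemma dual_eq_comap [Fintype ι] [DecidableEq ι] (C : Submodule K (ι → K)) :
    dual C = C.dualAnnihilator.comap (dotProductEquiv K ι).toLinearMap := by
  ext x
  simp only [mem_dual, Submodule.mem_comap, Submodule.mem_dualAnnihilator,
    LinearEquiv.coe_coe, dotProductEquiv_apply_apply]
  exact forall₂_congr fun c _ => by rw [dotProduct_comm]

lemma finrank_add_finrank_dual [Fintype ι] (C : Submodule K (ι → K)) :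
    Module.finrank K C + Module.finrank K (dual C) = Fintype.card ι := by
  classical
  have h : Module.finrank K (dual C) = Module.finrank K C.dualAnnihilator := by
    rw [dual_eq_comap]
    exact ((dotProductEquiv K ι).submoduleMap _).finrank_eq.trans
      (by rw [Submodule.map_comap_eq_of_surjective (dotProductEquiv K ι).surjective])
  rw [h, Subspace.finrank_add_finrank_dualAnnihilator_eq, Module.finrank_fintype_fun_eq_card]

lemma dual_dual [Fintype ι] (C : Submodule K (ι → K)) : dual (dual C) = C := by
  refine (Submodule.eq_of_le_of_finrank_eq ?_ ?_).symm
  · intro c hc x hx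
    rw [dotProduct_comm]
    exact hx c hc
  · have h₁ := finrank_add_finrank_dual C
    have h₂ := finrank_add_finrank_dual (dual C)
    omega

lemma dual_sup [Fintype ι] (C D : Submodule K (ι → K)) : dual (C ⊔ D) = dual C ⊓ dual D := by
  ext x
  simp only [Submodule.mem_inf, mem_dual]
  refine ⟨fun h => ⟨fun c hc => h c (Submodule.mem_sup_left hc),
    fun c hc => h c (Submodule.mem_sup_right hc)⟩, fun h c hc => ?_⟩
  obtain ⟨a, ha, b, hb, rfl⟩ := Submodule.mem_sup.mp hc
  rw [add_dotProduct, h.1 a ha, h.2 b hb, add_zero]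

lemma zeroOn_eq_inf (C : Submodule K (ι → K)) (T : Finset ι) :
    zeroOn C T = C ⊓ zeroOn ⊤ T := by
  ext x; simp [mem_zeroOn]

lemma finrank_zeroOn_top [Fintype ι] [DecidableEq ι] (T : Finset ι) :
    Module.finrank K (zeroOn (⊤ : Submodule K (ι → K)) T) = Tᶜ.card := by
  have h : zeroOn (⊤ : Submodule K (ι → K)) T =
      ⨅ i ∈ (↑T : Set ι), LinearMap.ker (LinearMap.proj i : (ι → K) →ₗ[K] K) := by
    ext x; simp [mem_zeroOn]
  rw [h, (LinearMap.iInfKerProjEquiv K (fun _ => K) (I := (↑Tᶜ : Set ι)) (J := (↑T : Set ι))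
    (by rw [Finset.coe_compl]; exact disjoint_compl_left) (by simp)).finrank_eq,
    Module.finrank_fintype_fun_eq_card]
  exact Fintype.card_coe Tᶜ

lemma dual_zeroOn_top [Fintype ι] [DecidableEq ι] (T : Finset ι) :
    dual (zeroOn (⊤ : Submodule K (ι → K)) T) = zeroOn ⊤ Tᶜ := by
  ext x
  simp only [mem_dual, mem_zeroOn, Submodule.mem_top, true_and, Finset.mem_compl]
  constructor
  · intro h i hi
    have := h (Pi.single i 1) (fun j hj => Pi.single_eq_of_ne (fun e => hi (by rwa [← e])) _)
    simpa using this
  · intro h c hc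
    refine Finset.sum_eq_zero fun i _ => ?_
    by_cases hi : i ∈ T
    · rw [hc i hi, zero_mul]
    · rw [h i hi, mul_zero]

/-- The corank formula for a code and its dual. -/
lemma finrank_zeroOn_add_card [Fintype ι] [DecidableEq ι] (C : Submodule K (ι → K))
    (T : Finset ι) :
    Module.finrank K (zeroOn C T) + T.card =
      Module.finrank K C + Module.finrank K (zeroOn (dual C) Tᶜ) := by
  -- The dual of this sum consists of the dual words supported in `T`; the formula for the dimension
  -- of a sum does the rest.
  have h₁ := finrank_add_finrank_dual (C ⊔ zeroOn ⊤ T)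
  rw [dual_sup, dual_zeroOn_top, ← zeroOn_eq_inf] at h₁
  have h₂ := Submodule.finrank_sup_add_finrank_inf_eq C (zeroOn ⊤ T)
  rw [← zeroOn_eq_inf, finrank_zeroOn_top] at h₂
  have h₃ := T.card_add_card_compl
  omega

lemma dotProduct_restrict [Fintype ι] [DecidableEq ι] {T : Finset ι} (c : ι → K) {y : ι → K}
    (hy : ∀ i ∈ T, y i = 0) :
    (fun i : {i // i ∉ T} => c i) ⬝ᵥ (fun i : {i // i ∉ T} => y i) = c ⬝ᵥ y := by
  simp only [dotProduct]
  rw [← Fintype.sum_subtype_add_sum_subtype (fun i => i ∉ T) (fun i => c i * y i),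
    Finset.sum_eq_zero (s := (Finset.univ : Finset {i // ¬ i ∉ T})), add_zero]
  intro i _
  rw [hy i (not_not.mp i.2), mul_zero]

lemma dual_puncture [Fintype ι] [DecidableEq ι] (C : Submodule K (ι → K)) (T : Finset ι) :
    dual (puncture C T) = shorten (dual C) T := by
  ext x
  rw [mem_shorten]
  constructor
  · intro hx
    -- Extending `x` by zero on `T` preserves all dot products with words of `C`.
    have h₀ : ∀ i ∈ T, (fun i => if h : i ∉ T then x ⟨i, h⟩ else 0) i = 0 := by
      intro i hi; simp [hi]
    have h₁ : (fun i : {i // i ∉ T} =>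
        (fun i => if h : i ∉ T then x ⟨i, h⟩ else 0) (i : ι)) = x := by
      ext i; exact dif_pos i.2
    refine ⟨_, fun c hc => ?_, h₀, h₁⟩
    rw [← dotProduct_restrict c h₀, h₁]
    exact hx _ ⟨c, hc, rfl⟩
  · rintro ⟨y, hy, h₀, rfl⟩ _ ⟨c, hc, rfl⟩
    exact (dotProduct_restrict c h₀).trans (hy c hc)

lemma dual_shorten [Fintype ι] [DecidableEq ι] (C : Submodule K (ι → K)) (T : Finset ι) :
    dual (shorten C T) = puncture (dual C) T := by
  rw [← dual_dual (puncture (dual C) T), dual_puncture, dual_dual]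

lemma dual_shorten_dual [Fintype ι] [DecidableEq ι] (C : Submodule K (ι → K)) (T : Finset ι) :
    dual (shorten (dual C) T) = puncture C T := by
  rw [dual_shorten, dual_dual]

end Duality

/-! ### Words determined by their supports -/

section Supports

variable {K : Type*} [Field K] [DecidableEq K] {P : Type*} [Fintype P]

lemma mem_supp {c : P → K} {i : P} : i ∈ supp c ↔ c i ≠ 0 := by
  simp [supp]

lemma card_supp (c : P → K) : (supp c).card = hammingNorm c := rfl

lemma supp_smul {a : K} (ha : a ≠ 0) (c : P → K) : supp (a • c) = supp c := by
  ext i; simp [mem_supp, ha]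

lemma hammingNorm_eq_of_supp_eq {c d : P → K} (h : supp c = supp d) :
    hammingNorm c = hammingNorm d := by
  rw [← card_supp, h, card_supp]

/-- Two words of the least nonzero weight with the same support are proportional. -/
lemma exists_smul_eq_of_supp_eq {C : Submodule K (P → K)} {w : ℕ}
    (hmin : ∀ c ∈ C, c ≠ 0 → w ≤ hammingNorm c) {x y : P → K} (hx : x ∈ C) (hy : y ∈ C)
    (hxw : hammingNorm x = w) (h : supp x = supp y) : ∃ a : K, y = a • x := by
  by_cases hx₀ : x = 0
  · refine ⟨0, ?_⟩
    subst hx₀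
    ext i
    by_contra hi
    have : i ∈ supp (0 : P → K) := h ▸ mem_supp.mpr (by simpa using hi)
    simp [mem_supp] at this
  · obtain ⟨i, hi⟩ := Function.ne_iff.mp hx₀
    have hi : x i ≠ 0 := hi
    -- This scalar cancels coordinate `i`, so the difference is supported strictly inside `supp x`;
    -- by minimality of the weight it vanishes.
    refine ⟨y i / x i, ?_⟩
    by_contra hne
    have hz : y - (y i / x i) • x ≠ 0 := sub_ne_zero.mpr hne
    have hle := hmin _ (C.sub_mem hy (C.smul_mem _ hx)) hz
    have hss : supp (y - (y i / x i) • x) ⊂ supp x := by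
      refine (Finset.ssubset_iff_of_subset ?_).mpr ⟨i, mem_supp.mpr hi, ?_⟩
      · intro j hj
        rw [mem_supp] at hj ⊢
        intro hxj
        have hyj : y j = 0 := by
          by_contra hyj
          exact (mem_supp.mp (h ▸ mem_supp.mpr hyj : j ∈ supp x)) hxj
        exact hj (by simp [hxj, hyj])
      · simp [mem_supp, hi]
    have := Finset.card_lt_card hss
    rw [card_supp, card_supp] at this
    omega

/-- If words of weight `w` are determined up to scalars by their supports, then the blocks are
the supports, each of them once. -/
lemma blocks_eq_val [Fintype K] [DecidableEq P] {C : Submodule K (P → K)} {w : ℕ} (hw : 0 < w)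
    (hprop : ∀ x ∈ C, ∀ y ∈ C, hammingNorm x = w → supp x = supp y → ∃ a : K, y = a • x)
    (F : Finset (Finset P)) (hF : ∀ b, b ∈ F ↔ ∃ x ∈ C, hammingNorm x = w ∧ supp x = b) :
    blocks C w = F.val := by
  classical
  unfold blocks divMultiplicities
  rw [← Finset.sum_multiset_singleton F]
  refine Finset.sum_congr ?_ ?_
  · ext b
    simp [hF, and_assoc]
  · intro b hb
    obtain ⟨x, hx, hxw, rfl⟩ := (hF b).mp hb
    have hx₀ : x ≠ 0 := by
      rintro rfl
      simp at hxw; omega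
    have hcount : Multiset.count (supp x)
        ((Finset.univ.filter fun c : P → K => c ∈ C ∧ hammingNorm c = w).val.map supp) =
        Fintype.card K - 1 := by
      rw [Multiset.count_map, ← Finset.filter_val, Finset.card_val, Finset.filter_filter,
        ← Fintype.card_units, ← Finset.card_univ]
      symm
      -- The words with the support of `x` are its multiples by units, so the multiplicity is
      -- exactly the divisor.
      refine Finset.card_bij (fun a _ => (a : K) • x) ?_ ?_ ?_
      · intro a _
        have hs := supp_smul a.ne_zero x
        simp only [Finset.mem_filter_univ]
        exact ⟨⟨C.smul_mem _ hx, (hammingNorm_eq_of_supp_eq hs).trans hxw⟩, hs.symm⟩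
      · intro a _ b _ hab
        exact Units.ext (smul_left_injective K hx₀ hab)
      · intro y hy
        obtain ⟨⟨hy, hyw⟩, hs⟩ := (Finset.mem_filter_univ y).mp hy
        obtain ⟨a, rfl⟩ := hprop x hx y hy hxw hs
        have ha : a ≠ 0 := by
          rintro rfl
          simp at hyw; omega
        exact ⟨Units.mk0 a ha, Finset.mem_univ _, rfl⟩
    have hK : 0 < Fintype.card K - 1 := Nat.sub_pos_of_lt Fintype.one_lt_card
    convert Multiset.replicate_one (supp x) using 2
    convert Nat.div_self hK

end Supports

/-! ### Counting zeros in subcodes -/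

section Words

variable {K : Type*} [Field K] {ι : Type*}

open Classical in
/-- The words of `C` that vanish on `T`, as a finite set. -/
noncomputable def words [Fintype K] [Fintype ι] (C : Submodule K (ι → K)) (T : Finset ι) :
    Finset (ι → K) :=
  Finset.univ.filter fun c => c ∈ zeroOn C T

/-- The set of zeros of a vector. -/
def zeros [DecidableEq K] [Fintype ι] (c : ι → K) : Finset ι :=
  Finset.univ.filter fun i => c i = 0

lemma mem_words [Fintype K] [Fintype ι] {C : Submodule K (ι → K)} {T : Finset ι} {c : ι → K} :
    c ∈ words C T ↔ c ∈ zeroOn C T := by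
  simp [words]

lemma mem_zeros [DecidableEq K] [Fintype ι] {c : ι → K} {i : ι} : i ∈ zeros c ↔ c i = 0 := by
  simp [zeros]

lemma mem_zeroOn_iff_subset [DecidableEq K] [Fintype ι] {C : Submodule K (ι → K)}
    {T : Finset ι} {c : ι → K} : c ∈ zeroOn C T ↔ c ∈ C ∧ T ⊆ zeros c := by
  simp only [mem_zeroOn, Finset.subset_iff, mem_zeros]

lemma card_zeros_add_hammingNorm [DecidableEq K] [Fintype ι] (c : ι → K) :
    (zeros c).card + hammingNorm c = Fintype.card ι := by
  exact Finset.card_filter_add_card_filter_not (s := Finset.univ) (fun i => c i = 0)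

lemma zeros_zero [DecidableEq K] [Fintype ι] : zeros (0 : ι → K) = Finset.univ := by
  ext i; simp [mem_zeros]

lemma zeros_eq_compl_supp [DecidableEq K] [Fintype ι] [DecidableEq ι] (c : ι → K) :
    zeros c = (supp c)ᶜ := by
  ext i; simp [mem_zeros, mem_supp]

lemma card_words [Fintype K] [Fintype ι] (C : Submodule K (ι → K)) (T : Finset ι) :
    (words C T).card = Fintype.card K ^ Module.finrank K (zeroOn C T) := by
  classical
  rw [← Nat.card_eq_fintype_card, ← Module.natCard_eq_pow_finrank, words,
    Nat.card_eq_fintype_card, Fintype.card_subtype]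

lemma zero_mem_words [Fintype K] [Fintype ι] (C : Submodule K (ι → K)) (T : Finset ι) :
    0 ∈ words C T := mem_words.mpr (Submodule.zero_mem _)

/-- Double counting of the pairs of a word and one of its zeros. -/
lemma sum_card_zeros [Fintype K] [DecidableEq K] [Fintype ι] [DecidableEq ι]
    (C : Submodule K (ι → K)) (T : Finset ι) :
    ∑ c ∈ words C T, (zeros c).card = ∑ i, (words C (insert i T)).card := by
  have h := Finset.sum_card_bipartiteAbove_eq_sum_card_bipartiteBelow
    (s := words C T) (t := (Finset.univ : Finset ι)) (fun c i => c i = 0)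
  simp only [Finset.bipartiteAbove, Finset.bipartiteBelow] at h
  refine h.trans (Finset.sum_congr rfl fun i _ => congrArg Finset.card ?_)
  ext c
  simp only [Finset.mem_filter, mem_words, mem_zeroOn, Finset.forall_mem_insert]
  tauto

/-- The zero word, which vanishes everywhere, is split off, and each coordinate of `T` is a zero of
every word counted. Bounds on the zeros of nonzero words can then be inserted. -/
lemma sum_card_zeros_erase [Fintype K] [DecidableEq K] [Fintype ι] [DecidableEq ι]
    (C : Submodule K (ι → K)) (T : Finset ι) :
    Fintype.card ι + ∑ c ∈ (words C T).erase 0, (zeros c).card =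
      T.card * (words C T).card + ∑ i ∈ Tᶜ, (words C (insert i T)).card := by
  have h₁ := Finset.add_sum_erase (words C T) (fun c => (zeros c).card) (zero_mem_words C T)
  simp only [zeros_zero, Finset.card_univ] at h₁
  rw [h₁, sum_card_zeros, ← Finset.sum_add_sum_compl T]
  congr 1
  rw [Finset.sum_congr rfl fun i hi => by rw [Finset.insert_eq_self.mpr hi], Finset.sum_const,
    smul_eq_mul]

/-- One more zero is one linear condition; this is read off from two instances of the corank
formula. -/
lemma finrank_zeroOn_le_insert [Fintype ι] [DecidableEq ι] (C : Submodule K (ι → K))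
    (T : Finset ι) (i : ι) :
    Module.finrank K (zeroOn C T) ≤ Module.finrank K (zeroOn C (insert i T)) + 1 := by
  have h₁ := finrank_zeroOn_add_card C T
  have h₂ := finrank_zeroOn_add_card C (insert i T)
  have h₃ := Submodule.finrank_mono (zeroOn_mono (C := dual C)
    (Finset.compl_subset_compl.mpr (Finset.subset_insert i T)))
  have h₄ := Finset.card_insert_le i T
  omega

end Words

/-! ### The inversive plane of an ovoid code -/

section Ovoid

variable {K : Type*} [Field K] [Fintype K] [DecidableEq K] {ι : Type*} [Fintype ι]
  [DecidableEq ι]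

/-- An ovoid code: a four-dimensional code of length `q ^ 2 + 1` whose nonzero words have at most
`q + 1` zeros, over the field with `q` elements. -/
structure IsOvoidCode (q : ℕ) (C : Submodule K (ι → K)) : Prop where
  card_field : Fintype.card K = q
  card_coord : Fintype.card ι = q ^ 2 + 1
  finrank_eq : Module.finrank K C = 4
  card_zeros_le : ∀ c ∈ C, c ≠ 0 → (zeros c).card ≤ q + 1

variable {q : ℕ} {C : Submodule K (ι → K)}

omit [DecidableEq ι] in
lemma IsOvoidCode.one_lt (hC : IsOvoidCode q C) : 1 < q :=
  hC.card_field ▸ Fintype.one_lt_card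

omit [DecidableEq ι] in
lemma IsOvoidCode.of_isCode (hK : Fintype.card K = q)
    (hC : IsCode C (q ^ 2 + 1) 4 (q ^ 2 - q)) : IsOvoidCode q C where
  card_field := hK
  card_coord := hC.1
  finrank_eq := hC.2.1
  card_zeros_le := by
    intro c hc hc₀
    have h₁ := hC.2.2.2 ⟨c, hc, 0, C.zero_mem, hc₀, hammingDist_zero_right c⟩
    have h₂ := card_zeros_add_hammingNorm c
    have h₃ : q ≤ q ^ 2 := Nat.le_self_pow two_ne_zero q
    rw [hC.1] at h₂
    omega

/-- The dimension is at least 4 - 3. If it were larger, the subcode would have qN words with N ≥ q,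
and at least N of them would vanish at each further coordinate: too many zeros when a nonzero word
has at most q+1. -/
lemma IsOvoidCode.finrank_zeroOn_three (hC : IsOvoidCode q C) {T : Finset ι}
    (hT : T.card = 3) : Module.finrank K (zeroOn C T) = 1 := by
  have hq := hC.one_lt
  have hlow := finrank_zeroOn_add_card C T
  rw [hC.finrank_eq, hT] at hlow
  by_contra hne
  obtain ⟨m, hm⟩ : ∃ m, Module.finrank K (zeroOn C T) = m + 2 :=
    ⟨Module.finrank K (zeroOn C T) - 2, by omega⟩
  have hW : (words C T).card = q * q ^ (m + 1) := by
    rw [card_words, hm, hC.card_field, ← pow_succ']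
  have hN : q ≤ q ^ (m + 1) := Nat.le_self_pow (by omega) q
  have hins : ∀ i ∈ Tᶜ, q ^ (m + 1) ≤ (words C (insert i T)).card := by
    intro i _
    have := finrank_zeroOn_le_insert C T i
    rw [card_words, hC.card_field]
    exact Nat.pow_le_pow_right (by omega) (by omega)
  have hsum := sum_card_zeros_erase C T
  have hup : ∑ c ∈ (words C T).erase 0, (zeros c).card ≤ ((words C T).card - 1) * (q + 1) := by
    rw [← Finset.card_erase_of_mem (zero_mem_words C T), ← smul_eq_mul]
    refine Finset.sum_le_card_nsmul _ _ _ fun c hc => ?_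
    rw [Finset.mem_erase, mem_words] at hc
    exact hC.card_zeros_le c hc.2.1 hc.1
  have hlow := Finset.card_nsmul_le_sum _ _ _ hins
  have hTc := T.card_add_card_compl
  rw [smul_eq_mul] at hlow
  rw [hC.card_coord] at hsum hTc
  rw [hT] at hsum hTc
  rw [hW] at hsum hup
  generalize q ^ (m + 1) = N at *
  obtain ⟨X, hX⟩ : ∃ X, q * N = X + 1 := ⟨q * N - 1, by
    have : 0 < q * N := Nat.mul_pos (by omega) (by omega)
    omega⟩
  rw [hX, Nat.add_sub_cancel] at hup
  have h₁ : 3 * (q * N) + Tᶜ.card * N ≤ q ^ 2 + 1 + X * (q + 1) := by omega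
  generalize Tᶜ.card = Y at *
  zify at *
  have hX' : (X : ℤ) = q * N - 1 := by linarith
  have hY' : (Y : ℤ) = q ^ 2 - 2 := by linarith
  rw [hX', hY'] at h₁
  -- The inequality amounts to 2N(q-1) ≤ q(q-1), against N ≥ q > 1.
  nlinarith

/-- After enlarging `T` to three points, the corank formula shows that no nonzero dual word is
supported there, hence none on `T`. -/
lemma IsOvoidCode.finrank_zeroOn_add_card (hC : IsOvoidCode q C) {T : Finset ι}
    (hT : T.card ≤ 3) : Module.finrank K (zeroOn C T) + T.card = 4 := by
  have hq := hC.one_lt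
  obtain ⟨S, hTS, -, hS⟩ := Finset.exists_subsuperset_card_eq (Finset.subset_univ T) hT
    (by rw [Finset.card_univ, hC.card_coord]; nlinarith)
  have h₁ := ShortenedCodes.finrank_zeroOn_add_card C S
  have h₂ := ShortenedCodes.finrank_zeroOn_add_card C T
  have h₃ := Submodule.finrank_mono (zeroOn_mono (C := dual C)
    (Finset.compl_subset_compl.mpr hTS))
  rw [hC.finrank_zeroOn_three hS, hS, hC.finrank_eq] at h₁
  rw [hC.finrank_eq] at h₂
  omega

lemma IsOvoidCode.card_words (hC : IsOvoidCode q C) {T : Finset ι} {k : ℕ}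
    (hT : T.card + k = 4) (hk : 0 < k) : (words C T).card = q ^ k := by
  have := hC.finrank_zeroOn_add_card (T := T) (by omega)
  rw [ShortenedCodes.card_words, hC.card_field]
  congr 1
  omega

/-- A nonzero word with two zeros has exactly `q + 1` zeros. -/
lemma IsOvoidCode.card_zeros_eq (hC : IsOvoidCode q C) {c : ι → K} (hc : c ∈ C) (hc₀ : c ≠ 0)
    (h : 2 ≤ (zeros c).card) : (zeros c).card = q + 1 := by
  have hq := hC.one_lt
  obtain ⟨T, hTc, hT⟩ := Finset.exists_subset_card_eq h
  have hsum := sum_card_zeros_erase C T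
  have hW := hC.card_words (T := T) (k := 2) (by omega) (by omega)
  have hins : ∀ i ∈ Tᶜ, (words C (insert i T)).card = q := by
    intro i hi
    rw [hC.card_words (k := 1) _ one_pos, pow_one]
    rw [Finset.card_insert_of_notMem (Finset.mem_compl.mp hi), hT]
  rw [Finset.sum_congr rfl hins, Finset.sum_const, smul_eq_mul, hW, hT] at hsum
  have hTc' := T.card_add_card_compl
  rw [hC.card_coord] at hsum hTc'
  have hle : ∀ d ∈ (words C T).erase 0, (zeros d).card ≤ q + 1 := by
    intro d hd
    rw [Finset.mem_erase, mem_words] at hd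
    exact hC.card_zeros_le d hd.2.1 hd.1
  -- The total number of zeros is (q²-1)(q+1), so the bound q+1 is attained by every nonzero word
  -- vanishing on `T`.
  refine (Finset.sum_eq_sum_iff_of_le hle).mp ?_ c ?_
  · rw [Finset.sum_const, smul_eq_mul, Finset.card_erase_of_mem (zero_mem_words C T), hW]
    obtain ⟨X, hX⟩ : ∃ X, q ^ 2 = X + 1 := ⟨q ^ 2 - 1, by
      have : 0 < q ^ 2 := by positivity
      omega⟩
    rw [hX, Nat.add_sub_cancel]
    generalize ∑ d ∈ (words C T).erase 0, (zeros d).card = s at *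
    have hY : Tᶜ.card = X := by omega
    rw [hY] at hsum
    nlinarith
  · rw [Finset.mem_erase, mem_words, mem_zeroOn_iff_subset]
    exact ⟨hc₀, hc, hTc⟩

/-- The secant plane sections of the ovoid: the zero sets of the words with `q + 1` zeros. -/
def circles (q : ℕ) (C : Submodule K (ι → K)) : Set (Finset ι) :=
  {Z | Z.card = q + 1 ∧ ∃ c ∈ C, c ≠ 0 ∧ zeros c = Z}

lemma IsOvoidCode.zeros_mem_circles (hC : IsOvoidCode q C) {c : ι → K} (hc : c ∈ C)
    (hc₀ : c ≠ 0) (h : 2 ≤ (zeros c).card) : zeros c ∈ circles q C :=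
  ⟨hC.card_zeros_eq hc hc₀ h, c, hc, hc₀, rfl⟩

/-- Three points lie on exactly one circle. -/
lemma IsOvoidCode.existsUnique_circle (hC : IsOvoidCode q C) {T : Finset ι} (hT : T.card = 3) :
    ∃! Z, Z ∈ circles q C ∧ T ⊆ Z := by
  have hone := hC.finrank_zeroOn_three hT
  -- The words vanishing on `T` form a line, and its nonzero words share their zero set.
  obtain ⟨v, hv₀, hv⟩ := finrank_eq_one_iff'.mp hone
  have hvm := mem_zeroOn_iff_subset.mp v.2
  have hv₀' : (v : ι → K) ≠ 0 := fun h => hv₀ (Subtype.ext h)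
  refine ⟨zeros (v : ι → K), ⟨hC.zeros_mem_circles hvm.1 hv₀' ?_, hvm.2⟩, ?_⟩
  · have := Finset.card_le_card hvm.2
    omega
  · rintro _ ⟨⟨-, c, hc, hc₀, rfl⟩, hTc⟩
    obtain ⟨a, ha⟩ := hv ⟨c, mem_zeroOn_iff_subset.mpr ⟨hc, hTc⟩⟩
    have hca : c = a • (v : ι → K) := (congrArg Subtype.val ha).symm
    have ha₀ : a ≠ 0 := by
      rintro rfl
      exact hc₀ (by rw [hca, zero_smul])
    ext i
    simp [mem_zeros, hca, ha₀]

lemma IsOvoidCode.four_le_hammingNorm (hC : IsOvoidCode q C) {x : ι → K} (hx : x ∈ dual C)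
    (hx₀ : x ≠ 0) : 4 ≤ hammingNorm x := by
  by_contra hlt
  have hlt' : (supp x).card ≤ 3 := by rw [card_supp]; omega
  have h₁ := hC.finrank_zeroOn_add_card hlt'
  have h₂ := ShortenedCodes.finrank_zeroOn_add_card C (supp x)
  rw [hC.finrank_eq] at h₂
  have h₃ : Module.finrank K (zeroOn (dual C) (supp x)ᶜ) = 0 := by omega
  rw [Submodule.finrank_eq_zero] at h₃
  have : x ∈ zeroOn (dual C) (supp x)ᶜ :=
    mem_zeroOn_iff_subset.mpr ⟨hx, (zeros_eq_compl_supp x).ge⟩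
  rw [h₃] at this
  exact hx₀ this

/-- The words of weight four of the dual code live on the concircular quadruples. -/
lemma IsOvoidCode.exists_dual_supp_iff (hC : IsOvoidCode q C) {S : Finset ι} (hS : S.card = 4) :
    (∃ x ∈ dual C, supp x = S) ↔ ∃ Z ∈ circles q C, S ⊆ Z := by
  have h := ShortenedCodes.finrank_zeroOn_add_card C S
  rw [hC.finrank_eq, hS] at h
  -- For four points the corank formula makes the two dimensions equal.
  have hbot : zeroOn C S = ⊥ ↔ zeroOn (dual C) Sᶜ = ⊥ := by
    rw [← Submodule.finrank_eq_zero, ← Submodule.finrank_eq_zero (S := zeroOn (dual C) Sᶜ)]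
    omega
  constructor
  · rintro ⟨x, hx, rfl⟩
    have hx₀ : x ≠ 0 := by
      rintro rfl
      simp [card_supp] at hS
    have hne : zeroOn C (supp x) ≠ ⊥ := fun h₀ => hx₀ <| by
      have : x ∈ zeroOn (dual C) (supp x)ᶜ :=
        mem_zeroOn_iff_subset.mpr ⟨hx, (zeros_eq_compl_supp x).ge⟩
      rwa [hbot.mp h₀] at this
    obtain ⟨c, hc, hc₀⟩ := Submodule.exists_mem_ne_zero_of_ne_bot hne
    rw [mem_zeroOn_iff_subset] at hc
    have := Finset.card_le_card hc.2
    exact ⟨_, hC.zeros_mem_circles hc.1 hc₀ (by omega), hc.2⟩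
  · rintro ⟨_, ⟨-, c, hc, hc₀, rfl⟩, hSc⟩
    have hne : zeroOn (dual C) Sᶜ ≠ ⊥ := fun h₀ => hc₀ <| by
      have : c ∈ zeroOn C S := mem_zeroOn_iff_subset.mpr ⟨hc, hSc⟩
      rwa [hbot.mpr h₀] at this
    obtain ⟨x, hx, hx₀⟩ := Submodule.exists_mem_ne_zero_of_ne_bot hne
    rw [mem_zeroOn_iff_subset, zeros_eq_compl_supp, Finset.compl_subset_compl] at hx
    refine ⟨x, hx.1, Finset.eq_of_subset_of_card_le hx.2 ?_⟩
    rw [hS, card_supp]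
    exact hC.four_le_hammingNorm hx.1 hx₀

end Ovoid

/-! ### Double counting in 2-designs -/

section PairDesigns

variable {P : Type*} [DecidableEq P]

/-- Every member of `F` has `k` points, and two distinct points lie on `l` members. -/
structure IsPairDesign (F : Finset (Finset P)) (k l : ℕ) : Prop where
  card_block : ∀ b ∈ F, b.card = k
  card_through : ∀ x y : P, x ≠ y → (F.filter fun b => x ∈ b ∧ y ∈ b).card = l

lemma IsPairDesign.isSimpleDesign [Fintype P] {F : Finset (Finset P)} {n k l : ℕ}
    (h : IsPairDesign F k l) (hn : Fintype.card P = n) (hn₂ : 2 ≤ n) (hk : 1 ≤ k) (hkn : k ≤ n) :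
    IsSimpleDesign F.val 2 n k l := by
  refine ⟨⟨hn, one_le_two, hn₂, hk, hkn, h.card_block, fun s hs => ?_⟩, F.nodup⟩
  obtain ⟨x, y, hxy, rfl⟩ := Finset.card_eq_two.mp hs
  rw [← h.card_through x y hxy, ← Finset.filter_val, Finset.card_val]
  simp only [Finset.insert_subset_iff, Finset.singleton_subset_iff]

/-- The family of the complements of the members of `F`. -/
def complFamily [Fintype P] (F : Finset (Finset P)) : Finset (Finset P) :=
  F.map ⟨compl, compl_injective⟩

lemma mem_complFamily [Fintype P] {F : Finset (Finset P)} {b : Finset P} :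
    b ∈ complFamily F ↔ bᶜ ∈ F := by
  simp only [complFamily, Finset.mem_map, Function.Embedding.coeFn_mk]
  exact ⟨by rintro ⟨a, ha, rfl⟩; rwa [compl_compl], fun h => ⟨_, h, compl_compl b⟩⟩

lemma complBlocks_complFamily [Fintype P] (F : Finset (Finset P)) :
    complBlocks (complFamily F).val = F.val := by
  simp [complBlocks, complFamily]

/-- Double counting of the incidences with the members of a family. -/
lemma sum_card_eq_sum_card_filter [Fintype P] (G : Finset (Finset P)) :
    ∑ b ∈ G, b.card = ∑ z, (G.filter fun b => z ∈ b).card := by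
  have h := Finset.sum_card_bipartiteAbove_eq_sum_card_bipartiteBelow
    (s := G) (t := (Finset.univ : Finset P)) (fun b z => z ∈ b)
  simpa [Finset.bipartiteAbove, Finset.bipartiteBelow] using h

/-- Incidences with the blocks through `x` are counted in two ways, the point `x` itself apart. -/
lemma IsPairDesign.card_through_point [Fintype P] {F : Finset (Finset P)} {k l : ℕ}
    (h : IsPairDesign F k l) (x : P) :
    (F.filter fun b => x ∈ b).card * k =
      (F.filter fun b => x ∈ b).card + (Fintype.card P - 1) * l := by
  have h₁ := sum_card_eq_sum_card_filter (F.filter fun b => x ∈ b)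
  rw [Finset.sum_congr rfl fun b hb => h.card_block b (Finset.mem_filter.mp hb).1,
    Finset.sum_const, smul_eq_mul] at h₁
  rw [h₁, ← Finset.add_sum_erase _ _ (Finset.mem_univ x), Finset.filter_filter]
  congr 1
  · simp only [and_self]
  · rw [Finset.sum_congr rfl fun y hy => by
      rw [Finset.filter_filter, h.card_through x y (Finset.ne_of_mem_erase hy).symm],
      Finset.sum_const, smul_eq_mul, Finset.card_erase_of_mem (Finset.mem_univ x),
      Finset.card_univ]

/-- Inclusion-exclusion gives b - 2r + l blocks, with b the number of blocks and r the number
through a point. The factor k(k-1) clears the denominators of b and r. -/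
lemma IsPairDesign.card_avoiding [Fintype P] {F : Finset (Finset P)} {k l : ℕ}
    (h : IsPairDesign F k l) {x y : P} (hxy : x ≠ y) :
    ((F.filter fun b => x ∉ b ∧ y ∉ b).card : ℤ) * (k * (k - 1)) =
      l * ((Fintype.card P - k) * (Fintype.card P - k - 1)) := by
  have hv : 1 ≤ Fintype.card P := Fintype.card_pos_iff.mpr ⟨x⟩
  have hr : ∀ z : P, ((F.filter fun b => z ∈ b).card : ℤ) * (k - 1) =
      (Fintype.card P - 1) * l := by
    intro z
    have := h.card_through_point z
    zify [hv] at this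
    linarith
  have hb : (F.card : ℤ) * k * (k - 1) = Fintype.card P * ((Fintype.card P - 1) * l) := by
    have h₁ := sum_card_eq_sum_card_filter F
    rw [Finset.sum_congr rfl h.card_block, Finset.sum_const, smul_eq_mul] at h₁
    have h₂ : (F.card : ℤ) * k = ∑ z, ((F.filter fun b => z ∈ b).card : ℤ) := by
      exact_mod_cast h₁
    rw [h₂, Finset.sum_mul, Finset.sum_congr rfl fun z _ => hr z, Finset.sum_const,
      Finset.card_univ, nsmul_eq_mul]
  have hunion : (F.filter fun b => x ∉ b ∧ y ∉ b).card +
      (F.filter fun b => x ∈ b ∨ y ∈ b).card = F.card := by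
    rw [← Finset.card_filter_add_card_filter_not (s := F) (fun b => x ∉ b ∧ y ∉ b)]
    congr 2
    ext b
    simp only [Finset.mem_filter]
    tauto
  have hie := Finset.card_union_add_card_inter (F.filter fun b => x ∈ b) (F.filter fun b => y ∈ b)
  rw [← Finset.filter_or, ← Finset.filter_and, h.card_through x y hxy] at hie
  have hx := hr x
  have hy := hr y
  zify at hunion hie
  have : ((F.filter fun b => x ∉ b ∧ y ∉ b).card : ℤ) = F.card -
      (F.filter fun b => x ∈ b).card - (F.filter fun b => y ∈ b).card + l := by linarith
  rw [this]
  linear_combination hb - k * hx - k * hy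

/-- The complementary design of a pair design. -/
lemma IsPairDesign.compl [Fintype P] {F : Finset (Finset P)} {k l l' : ℕ}
    (h : IsPairDesign F k l) (hk : 2 ≤ k)
    (hl' : (l' : ℤ) * (k * (k - 1)) =
      l * ((Fintype.card P - k) * (Fintype.card P - k - 1))) :
    IsPairDesign (complFamily F) (Fintype.card P - k) l' where
  card_block b hb := by
    have h₁ := h.card_block _ (mem_complFamily.mp hb)
    have h₂ := b.card_add_card_compl
    omega
  card_through x y hxy := by
    have h₁ := (h.card_avoiding hxy).trans hl'.symm
    have h₂ : ((k : ℤ) * (k - 1)) ≠ 0 := by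
      have : (2 : ℤ) ≤ k := by exact_mod_cast hk
      exact mul_ne_zero (by linarith) (by linarith)
    have h₃ := Nat.cast_injective (R := ℤ) (mul_right_cancel₀ h₂ h₁)
    rw [← h₃, complFamily, Finset.filter_map, Finset.card_map]
    simp

/-- The `k`-subsets of the members of `M`. -/
def subBlocks [Fintype P] (M : Finset (Finset P)) (k : ℕ) : Finset (Finset P) :=
  Finset.univ.filter fun b => b.card = k ∧ ∃ m ∈ M, b ⊆ m

lemma mem_subBlocks [Fintype P] {M : Finset (Finset P)} {k : ℕ} {b : Finset P} :
    b ∈ subBlocks M k ↔ b.card = k ∧ ∃ m ∈ M, b ⊆ m := by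
  simp [subBlocks]

lemma card_powersetCard_filter_pair {m : Finset P} {x y : P} (hxy : x ≠ y) (hx : x ∈ m)
    (hy : y ∈ m) (k : ℕ) :
    ((m.powersetCard (k + 2)).filter fun b => x ∈ b ∧ y ∈ b).card = (m.card - 2).choose k := by
  have hpair : ({x, y} : Finset P).card = 2 := Finset.card_pair hxy
  have hsub : ∀ {b : Finset P}, x ∈ b → y ∈ b → ({x, y} : Finset P) ⊆ b := fun h₁ h₂ =>
    Finset.insert_subset h₁ (Finset.singleton_subset_iff.mpr h₂)
  rw [← hpair, ← Finset.card_sdiff_of_subset (hsub hx hy), ← Finset.card_powersetCard]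
  -- Removing the pair is a bijection onto the `k`-subsets of the rest of `m`.
  refine Finset.card_nbij' (· \ {x, y}) (· ∪ {x, y}) ?_ ?_ ?_ ?_
  · intro b hb
    simp only [Finset.coe_filter, Finset.mem_powersetCard, Set.mem_ofPred_eq] at hb
    simp only [Finset.mem_coe, Finset.mem_powersetCard]
    refine ⟨Finset.sdiff_subset_sdiff hb.1.1 subset_rfl, ?_⟩
    rw [Finset.card_sdiff_of_subset (hsub hb.2.1 hb.2.2), hb.1.2, hpair, Nat.add_sub_cancel]
  · intro b hb
    simp only [Finset.mem_coe, Finset.mem_powersetCard] at hb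
    simp only [Finset.coe_filter, Finset.mem_powersetCard, Set.mem_ofPred_eq]
    have hd : Disjoint b {x, y} := Finset.disjoint_of_subset_left hb.1 Finset.sdiff_disjoint
    refine ⟨⟨Finset.union_subset (hb.1.trans Finset.sdiff_subset) (hsub hx hy), ?_⟩, by simp⟩
    rw [Finset.card_union_of_disjoint hd, hb.2, hpair]
  · intro b hb
    simp only [Finset.coe_filter, Set.mem_ofPred_eq] at hb
    exact Finset.sdiff_union_of_subset (hsub hb.2.1 hb.2.2)
  · intro b hb
    simp only [Finset.mem_coe, Finset.mem_powersetCard] at hb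
    have hd : Disjoint b {x, y} := Finset.disjoint_of_subset_left hb.1 Finset.sdiff_disjoint
    exact Finset.union_sdiff_cancel_right hd

/-- By `huniq` a sub-block lies in only one member of `M`, so summing over members counts it once.
-/
lemma card_subBlocks_through [Fintype P] {M : Finset (Finset P)} {k : ℕ}
    (huniq : ∀ b : Finset P, b.card = k + 2 → ∀ m ∈ M, ∀ m' ∈ M, b ⊆ m → b ⊆ m' → m = m')
    {x y : P} (hxy : x ≠ y) :
    ((subBlocks M (k + 2)).filter fun b => x ∈ b ∧ y ∈ b).card =
      ∑ m ∈ M.filter (fun m => x ∈ m ∧ y ∈ m), (m.card - 2).choose k := by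
  rw [← Finset.sum_congr rfl fun m hm => card_powersetCard_filter_pair hxy
    (Finset.mem_filter.mp hm).2.1 (Finset.mem_filter.mp hm).2.2 k, ← Finset.card_biUnion]
  · congr 1
    ext b
    simp only [Finset.mem_filter, mem_subBlocks, Finset.mem_biUnion, Finset.mem_powersetCard]
    constructor
    · rintro ⟨⟨hb, m, hm, hbm⟩, hx, hy⟩
      exact ⟨m, ⟨hm, hbm hx, hbm hy⟩, ⟨hbm, hb⟩, hx, hy⟩
    · rintro ⟨m, ⟨hm, -, -⟩, ⟨hbm, hb⟩, hx, hy⟩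
      exact ⟨⟨hb, m, hm, hbm⟩, hx, hy⟩
  · intro m hm m' hm' hne
    refine Finset.disjoint_left.mpr fun b hb hb' => hne ?_
    simp only [Finset.mem_filter, Finset.mem_powersetCard] at hb hb'
    simp only [Finset.coe_filter, Set.mem_ofPred_eq] at hm hm'
    exact huniq b hb.1.2 m hm.1 m' hm'.1 hb.1.1 hb'.1.1

end PairDesigns

/-! ### Inversive planes with a point removed -/

section PointedInversivePlane

/-- A circle geometry with one point removed: `L` are the circles through that point, `O` the
circles off it. -/
structure IsPointedPlane {P : Type*} [Fintype P] [DecidableEq P] (q : ℕ)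
    (L O : Finset (Finset P)) : Prop where
  two_le : 2 ≤ q
  card_points : Fintype.card P = q ^ 2
  card_line : ∀ b ∈ L, b.card = q
  card_circle : ∀ b ∈ O, b.card = q + 1
  existsUnique_line : ∀ x y : P, x ≠ y → ∃! l, l ∈ L ∧ x ∈ l ∧ y ∈ l
  existsUnique_block : ∀ T : Finset P, T.card = 3 → ∃! m, m ∈ L ∪ O ∧ T ⊆ m

variable {P : Type*} [Fintype P] [DecidableEq P] {q : ℕ} {L O : Finset (Finset P)}

namespace IsPointedPlane

lemma isPairDesign_lines (h : IsPointedPlane q L O) : IsPairDesign L q 1 where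
  card_block := h.card_line
  card_through x y hxy := by
    obtain ⟨l, hl, huniq⟩ := h.existsUnique_line x y hxy
    refine Finset.card_eq_one.mpr ⟨l, ?_⟩
    ext m
    rw [Finset.mem_filter, Finset.mem_singleton]
    exact ⟨huniq m, fun hm => hm ▸ hl⟩

lemma disjoint (h : IsPointedPlane q L O) : Disjoint L O := by
  refine Finset.disjoint_left.mpr fun b hb hb' => ?_
  have h₁ := h.card_line b hb
  have h₂ := h.card_circle b hb'
  omega

/-- Each third point lies on exactly one line or circle through `x` and `y`. Only one of these
blocks is a line, so counting incidences determines the number of circles. -/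
lemma isPairDesign_circles (h : IsPointedPlane q L O) : IsPairDesign O (q + 1) q where
  card_block := h.card_circle
  card_through x y hxy := by
    have hq := h.two_le
    have hL := h.isPairDesign_lines.card_through x y hxy
    have hdisj : Disjoint (L.filter fun b => x ∈ b ∧ y ∈ b) (O.filter fun b => x ∈ b ∧ y ∈ b) :=
      Finset.disjoint_filter_filter h.disjoint
    have hsum := sum_card_eq_sum_card_filter ((L ∪ O).filter fun b => x ∈ b ∧ y ∈ b)
    rw [← Finset.sum_add_sum_compl {x, y}, Finset.sum_pair hxy] at hsum
    have hother : ∀ z ∈ ({x, y} : Finset P)ᶜ,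
        (((L ∪ O).filter fun b => x ∈ b ∧ y ∈ b).filter fun b => z ∈ b).card = 1 := by
      intro z hz
      simp only [Finset.mem_compl, Finset.mem_insert, Finset.mem_singleton, not_or] at hz
      obtain ⟨m, hm, huniq⟩ := h.existsUnique_block {x, y, z}
        (Finset.card_eq_three.mpr ⟨x, y, z, hxy, Ne.symm hz.1, Ne.symm hz.2, rfl⟩)
      simp only [Finset.insert_subset_iff, Finset.singleton_subset_iff] at hm huniq
      refine Finset.card_eq_one.mpr ⟨m, ?_⟩
      ext b
      rw [Finset.filter_filter, Finset.mem_filter, Finset.mem_singleton]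
      exact ⟨fun hb => huniq b ⟨hb.1, hb.2.1.1, hb.2.1.2, hb.2.2⟩,
        fun hb => hb ▸ ⟨hm.1, ⟨hm.2.1, hm.2.2.1⟩, hm.2.2.2⟩⟩
    have hx : ((L ∪ O).filter fun b => x ∈ b ∧ y ∈ b).filter (fun b => x ∈ b) =
        (L ∪ O).filter fun b => x ∈ b ∧ y ∈ b :=
      Finset.filter_true_of_mem fun b hb => (Finset.mem_filter.mp hb).2.1
    have hy : ((L ∪ O).filter fun b => x ∈ b ∧ y ∈ b).filter (fun b => y ∈ b) =
        (L ∪ O).filter fun b => x ∈ b ∧ y ∈ b :=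
      Finset.filter_true_of_mem fun b hb => (Finset.mem_filter.mp hb).2.2
    have hcompl := ({x, y} : Finset P).card_add_card_compl
    rw [Finset.card_pair hxy, h.card_points] at hcompl
    rw [Finset.sum_congr rfl hother, hx, hy, Finset.filter_union, Finset.sum_union hdisj,
      Finset.card_union_of_disjoint hdisj,
      Finset.sum_congr rfl fun b hb => h.card_line b (Finset.mem_filter.mp hb).1,
      Finset.sum_congr rfl fun b hb => h.card_circle b (Finset.mem_filter.mp hb).1,
      Finset.sum_const, Finset.sum_const, Finset.sum_const, hL, smul_eq_mul, smul_eq_mul,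
      smul_eq_mul] at hsum
    generalize (O.filter fun b => x ∈ b ∧ y ∈ b).card = N at *
    generalize ({x, y} : Finset P)ᶜ.card = Y at *
    -- The count reads q + N(q+1) = 2(1+N) + (q²-2), that is N(q-1) = q(q-1).
    obtain ⟨p, rfl⟩ : ∃ p, q = p + 1 := ⟨q - 1, by omega⟩
    have hp : 0 < p := by omega
    refine Nat.eq_of_mul_eq_mul_right hp ?_
    nlinarith

lemma isPairDesign_compl_lines (h : IsPointedPlane q L O) :
    IsPairDesign (complFamily L) (q ^ 2 - q) (q ^ 2 - q - 1) := by
  have hq := h.two_le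
  have h₁ : q + 1 ≤ q ^ 2 := by nlinarith
  rw [← h.card_points]
  refine h.isPairDesign_lines.compl hq ?_
  rw [h.card_points, Nat.sub_sub]
  push_cast [h₁]
  ring

/-- The factor q-2 comes from q² - q - 2 = (q-2)(q+1), where q+1 cancels against the block size. -/
lemma isPairDesign_compl_circles (h : IsPointedPlane q L O) :
    IsPairDesign (complFamily O) (q ^ 2 - q - 1) ((q - 2) * (q ^ 2 - q - 1)) := by
  have hq := h.two_le
  have h₁ : q + 1 ≤ q ^ 2 := by nlinarith
  rw [Nat.sub_sub]
  nth_rw 1 [← h.card_points]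
  refine h.isPairDesign_circles.compl (by omega) ?_
  rw [h.card_points]
  push_cast [h₁, hq]
  ring

lemma isAffinePlane_lines (h : IsPointedPlane q L O) : IsAffinePlane L.val where
  nodup := L.nodup
  two_le_card l hl := (h.card_line l hl).symm ▸ h.two_le
  join := h.existsUnique_line
  parallel := by
    intro l hl x hx
    have hq := h.two_le
    have hr := h.isPairDesign_lines.card_through_point x
    rw [h.card_points, mul_one] at hr
    have hmeet : ∀ m ∈ L.filter (fun m => x ∈ m), (m ∩ l).card = if Disjoint l m then 0 else 1 := by
      intro m hm
      rw [Finset.mem_filter] at hm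
      split_ifs with hd
      · rw [Finset.card_eq_zero, Finset.inter_comm]
        exact Finset.disjoint_iff_inter_eq_empty.mp hd
      · refine le_antisymm (Finset.card_le_one.mpr fun a ha b hb => ?_) ?_
        · rw [Finset.mem_inter] at ha hb
          by_contra hab
          have := (h.existsUnique_line a b hab).unique ⟨hl, ha.2, hb.2⟩ ⟨hm.1, ha.1, hb.1⟩
          exact hx (this ▸ hm.2)
        · rw [Nat.succ_le_iff, Finset.card_pos, Finset.inter_comm]
          exact Finset.not_disjoint_iff_nonempty_inter.mp hd
    have hsum : ∑ m ∈ L.filter (fun m => x ∈ m), (m ∩ l).card = q := by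
      have h₁ := Finset.sum_card_bipartiteAbove_eq_sum_card_bipartiteBelow
        (s := L.filter fun m => x ∈ m) (t := l) (fun m z => z ∈ m)
      simp only [Finset.bipartiteAbove, Finset.bipartiteBelow] at h₁
      rw [Finset.sum_congr rfl fun m _ => by
        rw [Finset.inter_comm, ← Finset.filter_mem_eq_inter], h₁,
        Finset.sum_congr rfl fun z hz => by
          rw [Finset.filter_filter, h.isPairDesign_lines.card_through x z
            (by rintro rfl; exact hx hz)], Finset.sum_const, h.card_line l hl, smul_eq_mul,
        mul_one]
    rw [Finset.sum_congr rfl hmeet, Finset.sum_ite, Finset.sum_const_zero, zero_add,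
      Finset.sum_const, smul_eq_mul, mul_one] at hsum
    have hsplit := Finset.card_filter_add_card_filter_not (s := L.filter fun m => x ∈ m)
      (fun m => Disjoint l m)
    -- Of the q+1 lines through `x`, exactly q meet `l`, one for each of its points.
    have hone : ((L.filter fun m => x ∈ m).filter fun m => Disjoint l m).card = 1 := by
      have hr' : (L.filter fun m => x ∈ m).card = q + 1 := by
        generalize (L.filter fun m => x ∈ m).card = r at hr
        obtain ⟨p, rfl⟩ : ∃ p, q = p + 1 := ⟨q - 1, by omega⟩
        have hp : 0 < p := by omega
        have h₂ : (p + 1) ^ 2 - 1 = (p + 2) * p := by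
          rw [Nat.sub_eq_iff_eq_add (Nat.one_le_pow _ _ (by omega))]; ring
        rw [h₂] at hr
        refine Nat.eq_of_mul_eq_mul_right hp ?_
        nlinarith
      omega
    obtain ⟨m, hm⟩ := Finset.card_eq_one.mp hone
    have hiff : ∀ b, (b ∈ L.val ∧ x ∈ b ∧ Disjoint l b) ↔ b = m := by
      intro b
      rw [← Finset.mem_singleton, ← hm, Finset.mem_filter, Finset.mem_filter, and_assoc]
      rfl
    exact ⟨m, (hiff m).mpr rfl, fun b hb => (hiff b).mp hb⟩
  noncollinear := by
    have hq := h.two_le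
    have hcard : 1 < Fintype.card P := by rw [h.card_points]; nlinarith
    obtain ⟨x, y, hxy⟩ := Fintype.exists_pair_of_one_lt_card hcard
    obtain ⟨l, ⟨hl, hx, hy⟩, huniq⟩ := h.existsUnique_line x y hxy
    obtain ⟨z, hz⟩ : ∃ z, z ∉ l := by
      by_contra! hall
      have h₁ := h.card_line l hl
      rw [Finset.eq_univ_iff_forall.mpr hall, Finset.card_univ, h.card_points] at h₁
      nlinarith
    refine ⟨x, y, z, hxy, fun e => hz (e ▸ hx), fun e => hz (e ▸ hy), ?_⟩
    rintro m hm ⟨hmx, hmy, hmz⟩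
    exact hz (huniq m ⟨hm, hmx, hmy⟩ ▸ hmz)

lemma isPairDesign_subBlocks_three (h : IsPointedPlane q L O) :
    IsPairDesign (subBlocks L 3) 3 (q - 2) where
  card_block b hb := (mem_subBlocks.mp hb).1
  card_through x y hxy := by
    rw [card_subBlocks_through (k := 1) ?_ hxy,
      Finset.sum_congr rfl fun m hm => by rw [h.card_line m (Finset.mem_filter.mp hm).1],
      Finset.sum_const, h.isPairDesign_lines.card_through x y hxy, one_smul, Nat.choose_one_right]
    intro b hb m hm m' hm' hbm hbm'
    obtain ⟨u, hu, v, hv, huv⟩ := Finset.one_lt_card.mp (by omega : 1 < b.card)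
    exact (h.existsUnique_line u v huv).unique ⟨hm, hbm hu, hbm hv⟩ ⟨hm', hbm' hu, hbm' hv⟩

lemma isPairDesign_subBlocks_four (h : IsPointedPlane q L O) :
    IsPairDesign (subBlocks (L ∪ O) 4) 4 ((q - 2).choose 2 + q * (q - 1).choose 2) where
  card_block b hb := (mem_subBlocks.mp hb).1
  card_through x y hxy := by
    rw [card_subBlocks_through (k := 2) ?_ hxy, Finset.filter_union,
      Finset.sum_union (Finset.disjoint_filter_filter h.disjoint),
      Finset.sum_congr rfl fun m hm => by rw [h.card_line m (Finset.mem_filter.mp hm).1],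
      Finset.sum_const, h.isPairDesign_lines.card_through x y hxy, one_smul,
      Finset.sum_congr rfl fun m hm => by rw [h.card_circle m (Finset.mem_filter.mp hm).1],
      Finset.sum_const, h.isPairDesign_circles.card_through x y hxy, smul_eq_mul]
    · congr 3
    · intro b hb m hm m' hm' hbm hbm'
      -- Three points of a quadruple already determine the block containing it.
      obtain ⟨T, hTb, hT⟩ := Finset.exists_subset_card_eq (by omega : 3 ≤ b.card)
      exact (h.existsUnique_block T hT).unique ⟨hm, hTb.trans hbm⟩ ⟨hm', hTb.trans hbm'⟩

end IsPointedPlane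

end PointedInversivePlane

/-! ### Removing a point from the circle geometry -/

section Residue

variable {K : Type*} [Field K] [Fintype K] [DecidableEq K] {ι : Type*} [Fintype ι]
  [DecidableEq ι]

open Classical in
/-- The circles through `t`, without `t`. -/
noncomputable def circlesThrough (q : ℕ) (C : Submodule K (ι → K)) (t : ι) :
    Finset (Finset {i // i ∉ ({t} : Finset ι)}) :=
  Finset.univ.filter fun b => ∃ Z ∈ circles q C, t ∈ Z ∧ Z.subtype (· ∉ ({t} : Finset ι)) = b

open Classical in
/-- The circles that do not pass through `t`. -/
noncomputable def circlesOff (q : ℕ) (C : Submodule K (ι → K)) (t : ι) :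
    Finset (Finset {i // i ∉ ({t} : Finset ι)}) :=
  Finset.univ.filter fun b => ∃ Z ∈ circles q C, t ∉ Z ∧ Z.subtype (· ∉ ({t} : Finset ι)) = b

variable {q : ℕ} {C : Submodule K (ι → K)} {t : ι}

omit [Fintype K] in
lemma mem_circlesThrough {b : Finset {i // i ∉ ({t} : Finset ι)}} :
    b ∈ circlesThrough q C t ↔
      ∃ Z ∈ circles q C, t ∈ Z ∧ Z.subtype (· ∉ ({t} : Finset ι)) = b := by
  simp [circlesThrough]

omit [Fintype K] in
lemma mem_circlesOff {b : Finset {i // i ∉ ({t} : Finset ι)}} :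
    b ∈ circlesOff q C t ↔
      ∃ Z ∈ circles q C, t ∉ Z ∧ Z.subtype (· ∉ ({t} : Finset ι)) = b := by
  simp [circlesOff]

omit [Fintype K] in
lemma mem_circlesThrough_union_circlesOff {b : Finset {i // i ∉ ({t} : Finset ι)}} :
    b ∈ circlesThrough q C t ∪ circlesOff q C t ↔
      ∃ Z ∈ circles q C, Z.subtype (· ∉ ({t} : Finset ι)) = b := by
  rw [Finset.mem_union, mem_circlesThrough, mem_circlesOff]
  constructor
  · rintro (⟨Z, hZ, -, h⟩ | ⟨Z, hZ, -, h⟩) <;> exact ⟨Z, hZ, h⟩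
  · rintro ⟨Z, hZ, h⟩
    by_cases ht : t ∈ Z
    · exact Or.inl ⟨Z, hZ, ht, h⟩
    · exact Or.inr ⟨Z, hZ, ht, h⟩

omit [Fintype ι] in
lemma card_subtype_of_mem {Z : Finset ι} (h : t ∈ Z) :
    (Z.subtype (· ∉ ({t} : Finset ι))).card + 1 = Z.card := by
  rw [Finset.card_subtype, ← Finset.card_erase_add_one h, ← Finset.filter_ne']
  simp only [Finset.mem_singleton, ne_eq]

omit [Fintype ι] in
lemma card_subtype_of_notMem {Z : Finset ι} (h : t ∉ Z) :
    (Z.subtype (· ∉ ({t} : Finset ι))).card = Z.card := by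
  rw [Finset.card_subtype, Finset.filter_true_of_mem]
  intro i hi
  rw [Finset.mem_singleton]
  exact fun e => h (e ▸ hi)

omit [Fintype ι] in
/-- A set of points other than `t`, as a set of points. -/
lemma subset_subtype_iff {b : Finset {i // i ∉ ({t} : Finset ι)}} {Z : Finset ι} :
    b ⊆ Z.subtype (· ∉ ({t} : Finset ι)) ↔ b.map (Function.Embedding.subtype _) ⊆ Z := by
  simp only [Finset.subset_iff, Finset.mem_subtype, Finset.mem_map,
    Function.Embedding.coe_subtype]
  exact ⟨by rintro h _ ⟨i, hi, rfl⟩; exact h hi, fun h i hi => h ⟨i, hi, rfl⟩⟩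

/-- Both uniqueness axioms are the three-point axiom for circles: a line through two points is the
circle through them and `t`. -/
lemma IsOvoidCode.isPointedPlane (hC : IsOvoidCode q C) (t : ι) :
    IsPointedPlane q (circlesThrough q C t) (circlesOff q C t) where
  two_le := hC.one_lt
  card_points := by
    have := Fintype.card_subtype_compl (fun i => i ∈ ({t} : Finset ι))
    rw [this, hC.card_coord, Fintype.card_coe, Finset.card_singleton, Nat.add_sub_cancel]
  card_line := by
    intro b hb
    obtain ⟨Z, hZ, ht, rfl⟩ := mem_circlesThrough.mp hb
    exact Nat.add_right_cancel ((card_subtype_of_mem ht).trans hZ.1)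
  card_circle := by
    intro b hb
    obtain ⟨Z, hZ, ht, rfl⟩ := mem_circlesOff.mp hb
    exact (card_subtype_of_notMem ht).trans hZ.1
  existsUnique_line := by
    intro x y hxy
    have hx : t ≠ x := fun e => x.2 (Finset.mem_singleton.mpr e.symm)
    have hy : t ≠ y := fun e => y.2 (Finset.mem_singleton.mpr e.symm)
    obtain ⟨Z, hZ, huniq⟩ := hC.existsUnique_circle (Finset.card_eq_three.mpr
      ⟨t, x, y, hx, hy, fun e => hxy (Subtype.ext e), rfl⟩)
    simp only [Finset.insert_subset_iff, Finset.singleton_subset_iff] at hZ huniq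
    refine ⟨_, ⟨mem_circlesThrough.mpr ⟨Z, hZ.1, hZ.2.1, rfl⟩, Finset.mem_subtype.mpr hZ.2.2.1,
      Finset.mem_subtype.mpr hZ.2.2.2⟩, ?_⟩
    rintro b ⟨hb, hxb, hyb⟩
    obtain ⟨Z', hZ', ht, rfl⟩ := mem_circlesThrough.mp hb
    rw [Finset.mem_subtype] at hxb hyb
    rw [huniq Z' ⟨hZ', ht, hxb, hyb⟩]
  existsUnique_block := by
    intro T hT
    obtain ⟨Z, hZ, huniq⟩ := hC.existsUnique_circle
      (T := T.map (Function.Embedding.subtype _)) (by rw [Finset.card_map, hT])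
    refine ⟨_, ⟨mem_circlesThrough_union_circlesOff.mpr ⟨Z, hZ.1, rfl⟩,
      subset_subtype_iff.mpr hZ.2⟩, ?_⟩
    rintro b ⟨hb, hTb⟩
    obtain ⟨Z', hZ', rfl⟩ := mem_circlesThrough_union_circlesOff.mp hb
    rw [huniq Z' ⟨hZ', subset_subtype_iff.mp hTb⟩]

end Residue

/-! ### Identifying the blocks of the four codes -/

section Blocks

variable {K : Type*} [Field K] [Fintype K] [DecidableEq K] {ι : Type*} [Fintype ι]
  [DecidableEq ι] {q : ℕ} {C : Submodule K (ι → K)} {t : ι}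

omit [Fintype K] in
lemma compl_supp_restrict (c : ι → K) (T : Finset ι) :
    (supp fun i : {i // i ∉ T} => c i)ᶜ = (zeros c).subtype (· ∉ T) := by
  ext i; simp [mem_supp, mem_zeros]

omit [Fintype K] in
lemma supp_restrict (c : ι → K) (T : Finset ι) :
    (supp fun i : {i // i ∉ T} => c i) = (supp c).subtype (· ∉ T) := by
  ext i; simp [mem_supp]

omit [Fintype K] in
lemma hammingNorm_restrict_of_eq_zero {c : ι → K} (h : c t = 0) :
    hammingNorm (fun i : {i // i ∉ ({t} : Finset ι)} => c i) = hammingNorm c := by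
  rw [← card_supp, supp_restrict, card_subtype_of_notMem (by simpa [mem_supp] using h), card_supp]

omit [Fintype K] in
lemma hammingNorm_restrict_of_ne_zero {c : ι → K} (h : c t ≠ 0) :
    hammingNorm (fun i : {i // i ∉ ({t} : Finset ι)} => c i) + 1 = hammingNorm c := by
  rw [← card_supp, supp_restrict, card_subtype_of_mem (mem_supp.mpr h), card_supp]

omit [Fintype K] in
-- Lifts equality of supports back to the original code, where words of minimum weight are
-- proportional.
lemma supp_eq_of_restrict {c d : ι → K} (hcd : c t = 0 ↔ d t = 0)
    (h : (supp fun i : {i // i ∉ ({t} : Finset ι)} => c i) =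
      supp fun i : {i // i ∉ ({t} : Finset ι)} => d i) : supp c = supp d := by
  ext i
  by_cases hi : i = t
  · subst hi
    rw [mem_supp, mem_supp, not_iff_not, hcd]
  · have := congrArg (⟨i, by simpa using hi⟩ ∈ ·) h
    simpa [mem_supp] using this

namespace IsOvoidCode

lemma zeros_mem_circles_iff (hC : IsOvoidCode q C) {c : ι → K} (hc : c ∈ C) :
    zeros c ∈ circles q C ↔ hammingNorm c = q ^ 2 - q := by
  have hq := hC.one_lt
  have h₁ := card_zeros_add_hammingNorm c
  rw [hC.card_coord] at h₁
  have h₂ : 2 * q ≤ q ^ 2 := by nlinarith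
  constructor
  · intro h
    have := h.1
    omega
  · intro h
    have hc₀ : c ≠ 0 := by
      rintro rfl
      rw [hammingNorm_zero] at h
      omega
    exact hC.zeros_mem_circles hc hc₀ (by omega)

omit [DecidableEq ι] in
lemma le_hammingNorm (hC : IsOvoidCode q C) {c : ι → K} (hc : c ∈ C) (hc₀ : c ≠ 0) :
    q ^ 2 - q ≤ hammingNorm c := by
  have h₁ := card_zeros_add_hammingNorm c
  have h₂ := hC.card_zeros_le c hc hc₀
  rw [hC.card_coord] at h₁
  omega

omit [DecidableEq ι] in
lemma exists_smul_eq_of_supp_eq (hC : IsOvoidCode q C) {c d : ι → K} (hc : c ∈ C) (hd : d ∈ C)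
    (hw : hammingNorm c = q ^ 2 - q) (h : supp c = supp d) : ∃ a : K, d = a • c :=
  ShortenedCodes.exists_smul_eq_of_supp_eq (fun _ => hC.le_hammingNorm) hc hd hw h

/-- No word has exactly `q` zeros. -/
lemma hammingNorm_ne (hC : IsOvoidCode q C) {c : ι → K} (hc : c ∈ C) :
    hammingNorm c ≠ q ^ 2 - q + 1 := by
  intro h
  have hq := hC.one_lt
  have h₁ := card_zeros_add_hammingNorm c
  rw [hC.card_coord] at h₁
  have h₂ : q ≤ q ^ 2 := Nat.le_self_pow two_ne_zero q
  have hc₀ : c ≠ 0 := by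
    rintro rfl
    rw [hammingNorm_zero] at h
    omega
  -- This weight leaves q zeros; as q ≥ 2, there would have to be q+1 of them.
  have h₃ := hC.card_zeros_eq hc hc₀ (by omega)
  omega

lemma blocks_shorten (hC : IsOvoidCode q C) (t : ι) :
    blocks (shorten C {t}) (q ^ 2 - q) = (complFamily (circlesThrough q C t)).val := by
  have hq := hC.one_lt
  refine blocks_eq_val (Nat.sub_pos_of_lt (by nlinarith)) ?_ _ ?_
  · intro x hx y hy hxw hs
    obtain ⟨c, hc, hct, rfl⟩ := mem_shorten.mp hx
    obtain ⟨d, hd, hdt, rfl⟩ := mem_shorten.mp hy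
    have hct := hct t (Finset.mem_singleton_self t)
    have hdt := hdt t (Finset.mem_singleton_self t)
    rw [hammingNorm_restrict_of_eq_zero hct] at hxw
    obtain ⟨a, rfl⟩ := hC.exists_smul_eq_of_supp_eq hc hd hxw
      (supp_eq_of_restrict (by simp [hct, hdt]) hs)
    exact ⟨a, rfl⟩
  · intro b
    rw [mem_complFamily, mem_circlesThrough]
    constructor
    · rintro ⟨_, hZ, ht, hb⟩
      obtain ⟨-, c, hc, -, rfl⟩ := id hZ
      rw [mem_zeros] at ht
      refine ⟨_, mem_shorten.mpr ⟨c, hc, by simpa using ht, rfl⟩, ?_, ?_⟩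
      · rw [hammingNorm_restrict_of_eq_zero ht, ← hC.zeros_mem_circles_iff hc]
        exact hZ
      · rw [← compl_inj_iff, compl_supp_restrict, hb]
    · rintro ⟨x, hx, hw, rfl⟩
      obtain ⟨c, hc, hct, rfl⟩ := mem_shorten.mp hx
      have hct := hct t (Finset.mem_singleton_self t)
      rw [hammingNorm_restrict_of_eq_zero hct] at hw
      exact ⟨_, (hC.zeros_mem_circles_iff hc).mpr hw, mem_zeros.mpr hct,
        (compl_supp_restrict c _).symm⟩

/-- A word nonzero at `t` would have weight q²-q+1 before puncturing, which `hammingNorm_ne`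
excludes. So puncturing yields only the blocks of the shortened code. -/
lemma blocks_puncture (hC : IsOvoidCode q C) (t : ι) :
    blocks (puncture C {t}) (q ^ 2 - q) = (complFamily (circlesThrough q C t)).val := by
  have hq := hC.one_lt
  have hzero : ∀ c ∈ C, hammingNorm (fun i : {i // i ∉ ({t} : Finset ι)} => c i) = q ^ 2 - q →
      c t = 0 := by
    intro c hc hw
    by_contra hct
    have := hammingNorm_restrict_of_ne_zero hct
    exact hC.hammingNorm_ne hc (by omega)
  have hiff : ∀ x, (x ∈ puncture C {t} ∧ hammingNorm x = q ^ 2 - q) ↔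
      (x ∈ shorten C {t} ∧ hammingNorm x = q ^ 2 - q) := by
    refine fun x => and_congr_left fun hw => ?_
    rw [mem_puncture, mem_shorten]
    constructor
    · rintro ⟨c, hc, rfl⟩
      exact ⟨c, hc, by simpa using hzero c hc hw, rfl⟩
    · rintro ⟨c, hc, -, rfl⟩
      exact ⟨c, hc, rfl⟩
  rw [← hC.blocks_shorten t]
  unfold blocks
  refine congrArg (fun S : Finset _ => divMultiplicities (S.val.map supp) _) ?_
  ext x
  simp only [Finset.mem_filter_univ]
  exact hiff x

/-- The weight is one below the minimum of `C`, so such a word has lost a nonzero coordinate at `t`: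
its zero set is a circle off `t`. -/
lemma blocks_puncture_sub_one (hC : IsOvoidCode q C) (t : ι) :
    blocks (puncture C {t}) (q ^ 2 - q - 1) = (complFamily (circlesOff q C t)).val := by
  have hq := hC.one_lt
  have hpos : 1 < q ^ 2 - q := by
    have : 2 * q ≤ q ^ 2 := by nlinarith
    omega
  have hne : ∀ c ∈ C,
      hammingNorm (fun i : {i // i ∉ ({t} : Finset ι)} => c i) = q ^ 2 - q - 1 →
      c t ≠ 0 ∧ hammingNorm c = q ^ 2 - q := by
    intro c hc hw
    have hct : c t ≠ 0 := by
      intro hct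
      rw [hammingNorm_restrict_of_eq_zero hct] at hw
      have hc₀ : c ≠ 0 := by
        rintro rfl
        rw [hammingNorm_zero] at hw
        omega
      have := hC.le_hammingNorm hc hc₀
      omega
    have := hammingNorm_restrict_of_ne_zero hct
    exact ⟨hct, by omega⟩
  refine blocks_eq_val (by omega) ?_ _ ?_
  · intro x hx y hy hxw hs
    obtain ⟨c, hc, rfl⟩ := mem_puncture.mp hx
    obtain ⟨d, hd, rfl⟩ := mem_puncture.mp hy
    have hcw := hne c hc hxw
    have hdw := hne d hd ((hammingNorm_eq_of_supp_eq hs).symm.trans hxw)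
    obtain ⟨a, rfl⟩ := hC.exists_smul_eq_of_supp_eq hc hd hcw.2
      (supp_eq_of_restrict (iff_of_false hcw.1 hdw.1) hs)
    exact ⟨a, rfl⟩
  · intro b
    rw [mem_complFamily, mem_circlesOff]
    constructor
    · rintro ⟨_, hZ, ht, hb⟩
      obtain ⟨-, c, hc, -, rfl⟩ := id hZ
      rw [mem_zeros] at ht
      refine ⟨_, mem_puncture.mpr ⟨c, hc, rfl⟩, ?_, ?_⟩
      · have h₁ := (hC.zeros_mem_circles_iff hc).mp hZ
        have h₂ := hammingNorm_restrict_of_ne_zero ht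
        omega
      · rw [← compl_inj_iff, compl_supp_restrict, hb]
    · rintro ⟨x, hx, hw, rfl⟩
      obtain ⟨c, hc, rfl⟩ := mem_puncture.mp hx
      have hcw := hne c hc hw
      exact ⟨_, (hC.zeros_mem_circles_iff hc).mpr hcw.2, fun h => hcw.1 (mem_zeros.mp h),
        (compl_supp_restrict c _).symm⟩

lemma exists_smul_eq_of_supp_eq_dual (hC : IsOvoidCode q C) {c d : ι → K} (hc : c ∈ dual C)
    (hd : d ∈ dual C) (hw : hammingNorm c = 4) (h : supp c = supp d) : ∃ a : K, d = a • c :=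
  ShortenedCodes.exists_smul_eq_of_supp_eq (fun _ => hC.four_le_hammingNorm) hc hd hw h

lemma blocks_shorten_dual (hC : IsOvoidCode q C) (t : ι) :
    blocks (shorten (dual C) {t}) 4 =
      (subBlocks (circlesThrough q C t ∪ circlesOff q C t) 4).val := by
  refine blocks_eq_val (by omega) ?_ _ ?_
  · intro x hx y hy hxw hs
    obtain ⟨c, hc, hct, rfl⟩ := mem_shorten.mp hx
    obtain ⟨d, hd, hdt, rfl⟩ := mem_shorten.mp hy
    have hct := hct t (Finset.mem_singleton_self t)
    have hdt := hdt t (Finset.mem_singleton_self t)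
    rw [hammingNorm_restrict_of_eq_zero hct] at hxw
    obtain ⟨a, rfl⟩ := hC.exists_smul_eq_of_supp_eq_dual hc hd hxw
      (supp_eq_of_restrict (by simp [hct, hdt]) hs)
    exact ⟨a, rfl⟩
  · intro b
    simp only [mem_subBlocks, mem_circlesThrough_union_circlesOff]
    constructor
    · rintro ⟨hb, _, ⟨Z, hZ, rfl⟩, hbZ⟩
      obtain ⟨c, hc, hcb⟩ := (hC.exists_dual_supp_iff
        ((Finset.card_map _).trans hb)).mpr ⟨Z, hZ, subset_subtype_iff.mp hbZ⟩
      have hct : c t = 0 := by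
        by_contra hct
        have : t ∈ supp c := mem_supp.mpr hct
        simp [hcb] at this
      refine ⟨_, mem_shorten.mpr ⟨c, hc, by simpa using hct, rfl⟩, ?_, ?_⟩
      · rw [hammingNorm_restrict_of_eq_zero hct, ← card_supp, hcb, Finset.card_map, hb]
      · rw [supp_restrict, hcb]
        ext i
        simp [show (i : ι) ≠ t from fun e => i.2 (Finset.mem_singleton.mpr e)]
    · rintro ⟨x, hx, hw, rfl⟩
      obtain ⟨c, hc, hct, rfl⟩ := mem_shorten.mp hx
      have hct := hct t (Finset.mem_singleton_self t)
      refine ⟨hw, ?_⟩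
      rw [hammingNorm_restrict_of_eq_zero hct] at hw
      obtain ⟨Z, hZ, hcZ⟩ := (hC.exists_dual_supp_iff hw).mp ⟨c, hc, rfl⟩
      refine ⟨_, ⟨Z, hZ, rfl⟩, ?_⟩
      rw [supp_restrict]
      exact Finset.subtype_mono hcZ

/-- Weight 3 lies below the dual minimum, so the word had weight 4 with `t` in its support. The
triple together with `t` is concircular, which makes it collinear after removing `t`. -/
lemma blocks_puncture_dual (hC : IsOvoidCode q C) (t : ι) :
    blocks (puncture (dual C) {t}) 3 = (subBlocks (circlesThrough q C t) 3).val := by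
  have hne : ∀ c ∈ dual C, hammingNorm (fun i : {i // i ∉ ({t} : Finset ι)} => c i) = 3 →
      c t ≠ 0 ∧ hammingNorm c = 4 := by
    intro c hc hw
    have hct : c t ≠ 0 := by
      intro hct
      rw [hammingNorm_restrict_of_eq_zero hct] at hw
      have hc₀ : c ≠ 0 := by
        rintro rfl
        rw [hammingNorm_zero] at hw
        omega
      have := hC.four_le_hammingNorm hc hc₀
      omega
    have := hammingNorm_restrict_of_ne_zero hct
    exact ⟨hct, by omega⟩
  refine blocks_eq_val (by omega) ?_ _ ?_
  · intro x hx y hy hxw hs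
    obtain ⟨c, hc, rfl⟩ := mem_puncture.mp hx
    obtain ⟨d, hd, rfl⟩ := mem_puncture.mp hy
    have hcw := hne c hc hxw
    have hdw := hne d hd ((hammingNorm_eq_of_supp_eq hs).symm.trans hxw)
    obtain ⟨a, rfl⟩ := hC.exists_smul_eq_of_supp_eq_dual hc hd hcw.2
      (supp_eq_of_restrict (iff_of_false hcw.1 hdw.1) hs)
    exact ⟨a, rfl⟩
  · intro b
    simp only [mem_subBlocks, mem_circlesThrough]
    constructor
    · rintro ⟨hb, _, ⟨Z, hZ, ht, rfl⟩, hbZ⟩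
      have hS : (insert t (b.map (Function.Embedding.subtype (· ∉ ({t} : Finset ι))))).card = 4 := by
        rw [Finset.card_insert_of_notMem (by simp), Finset.card_map, hb]
      obtain ⟨c, hc, hcb⟩ := (hC.exists_dual_supp_iff hS).mpr
        ⟨Z, hZ, Finset.insert_subset ht (subset_subtype_iff.mp hbZ)⟩
      have hcs : (supp fun i : {i // i ∉ ({t} : Finset ι)} => c i) = b := by
        rw [supp_restrict, hcb]
        ext i
        simp [show (i : ι) ≠ t from fun e => i.2 (Finset.mem_singleton.mpr e)]
      exact ⟨_, mem_puncture.mpr ⟨c, hc, rfl⟩, by rw [← card_supp, hcs, hb], hcs⟩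
    · rintro ⟨x, hx, hw, rfl⟩
      obtain ⟨c, hc, rfl⟩ := mem_puncture.mp hx
      have hcw := hne c hc hw
      obtain ⟨Z, hZ, hcZ⟩ := (hC.exists_dual_supp_iff hcw.2).mp ⟨c, hc, rfl⟩
      refine ⟨hw, _, ⟨Z, hZ, hcZ (mem_supp.mpr hcw.1), rfl⟩, ?_⟩
      rw [supp_restrict]
      exact Finset.subtype_mono hcZ

end IsOvoidCode

end Blocks

end ShortenedCodes

/-! ### The designs of the shortened codes and their duals -/

theorem mainTheorem6 {K : Type*} [Field K] [Fintype K] [DecidableEq K]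
    {ι : Type*} [Fintype ι] [DecidableEq ι]
    (q : ℕ) (hK : Fintype.card K = q) (hq : 4 ≤ q)
    (C : Submodule K (ι → K)) (hC : ShortenedCodes.IsCode C (q ^ 2 + 1) 4 (q ^ 2 - q))
    (t₁ : ι) :
    -- the shortened code of `C`
    (ShortenedCodes.IsSimpleDesign
        (ShortenedCodes.blocks (ShortenedCodes.shorten C {t₁}) (q ^ 2 - q))
        2 (q ^ 2) (q ^ 2 - q) (q ^ 2 - q - 1)) ∧
    -- the dual of the shortened code of `C`
    (∃ l : ℕ, 0 < l ∧ ShortenedCodes.IsSimpleDesign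
        (ShortenedCodes.blocks (ShortenedCodes.dual (ShortenedCodes.shorten C {t₁})) 3)
        2 (q ^ 2) 3 l) ∧
    -- the dual of the shortened code of the dual of `C`, blocks of size `q ^ 2 - q - 1`
    (ShortenedCodes.IsSimpleDesign
        (ShortenedCodes.blocks
          (ShortenedCodes.dual (ShortenedCodes.shorten (ShortenedCodes.dual C) {t₁}))
          (q ^ 2 - q - 1))
        2 (q ^ 2) (q ^ 2 - q - 1) ((q - 2) * (q ^ 2 - q - 1)) ∧
      ShortenedCodes.IsDesign
        (ShortenedCodes.complBlocks (ShortenedCodes.blocks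
          (ShortenedCodes.dual (ShortenedCodes.shorten (ShortenedCodes.dual C) {t₁}))
          (q ^ 2 - q - 1)))
        2 (q ^ 2) (q + 1) q) ∧
    -- the same code, blocks of size `q ^ 2 - q`
    (ShortenedCodes.IsSimpleDesign
        (ShortenedCodes.blocks
          (ShortenedCodes.dual (ShortenedCodes.shorten (ShortenedCodes.dual C) {t₁}))
          (q ^ 2 - q))
        2 (q ^ 2) (q ^ 2 - q) (q ^ 2 - q - 1) ∧
      ShortenedCodes.IsSteinerSystem
        (ShortenedCodes.complBlocks (ShortenedCodes.blocks
          (ShortenedCodes.dual (ShortenedCodes.shorten (ShortenedCodes.dual C) {t₁}))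
          (q ^ 2 - q)))
        2 q (q ^ 2) ∧
      ShortenedCodes.IsAffinePlane
        (ShortenedCodes.complBlocks (ShortenedCodes.blocks
          (ShortenedCodes.dual (ShortenedCodes.shorten (ShortenedCodes.dual C) {t₁}))
          (q ^ 2 - q)))) ∧
    -- the shortened code of the dual of `C`
    (∃ l : ℕ, 0 < l ∧ ShortenedCodes.IsSimpleDesign
        (ShortenedCodes.blocks (ShortenedCodes.shorten (ShortenedCodes.dual C) {t₁}) 4)
        2 (q ^ 2) 4 l) := by
  have hO := ShortenedCodes.IsOvoidCode.of_isCode hK hC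
  have hP := hO.isPointedPlane t₁
  have h₁ : 4 * q ≤ q ^ 2 := by nlinarith
  have h₂ := hP.isPairDesign_compl_lines.isSimpleDesign hP.card_points
    (by omega) (by omega) (by omega)
  -- Duals of shortened codes become punctured codes, and every block family becomes one of the
  -- pointed plane.
  rw [ShortenedCodes.dual_shorten, ShortenedCodes.dual_shorten_dual, hO.blocks_shorten,
    hO.blocks_puncture, hO.blocks_puncture_sub_one, hO.blocks_puncture_dual,
    hO.blocks_shorten_dual, ShortenedCodes.complBlocks_complFamily,
    ShortenedCodes.complBlocks_complFamily]
  refine ⟨h₂, ⟨q - 2, by omega, ?_⟩, ⟨?_, ?_⟩, ⟨h₂, ⟨le_rfl, ?_⟩, hP.isAffinePlane_lines⟩,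
    ⟨(q - 2).choose 2 + q * (q - 1).choose 2, ?_, ?_⟩⟩
  · exact hP.isPairDesign_subBlocks_three.isSimpleDesign hP.card_points
      (by omega) (by omega) (by omega)
  · exact hP.isPairDesign_compl_circles.isSimpleDesign hP.card_points
      (by omega) (by omega) (by omega)
  · exact (hP.isPairDesign_circles.isSimpleDesign hP.card_points
      (by omega) (by omega) (by omega)).1
  · exact (hP.isPairDesign_lines.isSimpleDesign hP.card_points
      (by omega) (by omega) (by omega)).1
  -- The quadruples inside lines alone make the parameter positive, since q - 2 ≥ 2.
  · exact Nat.add_pos_left (Nat.choose_pos (by omega)) _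
  · exact hP.isPairDesign_subBlocks_four.isSimpleDesign hP.card_points
      (by omega) (by omega) (by omega)
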